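/- Let $\mathcal{A}$ be an abelian category with coproducts indexed by arbitrary sets (an AB3 abelian category), let $D(\mathcal{A})$ be its (unbounded) derived category and $(D^{\leq 0}, D^{\geq 0})$ the standard $t$-structure on $D(\mathcal{A})$. The following statements are equivalent. (a) $\mathcal{A}$ is AB4, i.e. coproducts in $\mathcal{A}$ are exact. (b) $D(\mathcal{A})$ has coproducts and the standard $t$-structure is smashing, i.e. every object of $D(\mathcal{A})$ that is a coproduct in $D(\mathcal{A})$ of a family of objects of $D^{\geq 0}$ lies in $D^{\geq 0}$. (c) Coproducts in $\mathcal{A}$ are coproducts in $D(\mathcal{A})$: for every set $I\neq\emptyset$ and every family $(A_i)_{i\in I}$ of objects of $\mathcal{A}$, the coproduct $\coprod_{i\in I}A_i$ in $\mathcal{A}$ with its canonical inclusions $\mu_i : A_i\to\coprod_{i\in I}A_i$, regarded in $D(\mathcal{A})$ as stalk complexes in degree $0$, is a coproduct of $(A_i)_{i\in I}$ in $D(\mathcal{A})$. (d) For every set $I\neq\emptyset$, every family $(A_i)_{i\in I}$ of objects of $\mathcal{A}$ and every object $B$ of $\mathcal{A}$, the natural homomorphism $$\operatorname{Ext}^1_{\mathcal{A}}\Big(\coprod_{i\in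 I}A_i, B\Big)\longrightarrow\prod_{i\in I}\operatorname{Ext}^1_{\mathcal{A}}(A_i,B),\qquad \eta\longmapsto(\eta\cdot\mu_i)_{i\in I},$$ is an isomorphism. -/

import Mathlib

open CategoryTheory CategoryTheory.Limits

universe w w₁ w₂ v u

/-- `Free(P)`: the class of all objects which are a coproduct of some family, indexed by a set,
of objects satisfying `P`. -/
def coproductClass {D : Type u} [Category.{v} D] (P : ObjectProperty D) :
    ObjectProperty D := fun Y =>
  ∃ (I : Type w) (X : I → D) (μ : ∀ i, X i ⟶ Y),
    (∀ i, P (X i)) ∧ Nonempty (IsColimit (Cofan.mk Y μ))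

/-- A t-structure is smashing if its coaisle `D^{≥ 0}` is closed under coproducts, that is,
`Free(D^{≥ 0}) = D^{≥ 0}`. -/
def IsSmashing {D : Type u} [Category.{v} D] [Preadditive D] [HasZeroObject D]
    [HasShift D ℤ] [∀ n : ℤ, (shiftFunctor D n).Additive] [Pretriangulated D]
    (t : Triangulated.TStructure D) : Prop :=
  coproductClass.{w} (t.ge 0) = t.ge 0

/-- The canonical homomorphism `Ext¹(∐ᵢ Aᵢ, B) → ∏ᵢ Ext¹(Aᵢ, B)`, `η ↦ (η · μᵢ)ᵢ`, where
`μᵢ : Aᵢ → ∐ᵢ Aᵢ` are the canonical inclusions. -/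
noncomputable def extOneCoproductComparison {𝒜 : Type u} [Category.{v} 𝒜]
    [Abelian 𝒜] [HasExt.{w₂} 𝒜] {I : Type w} (A : I → 𝒜) [HasCoproduct A] (B : 𝒜) :
    Abelian.Ext.{w₂} (∐ A) B 1 →+ (∀ i, Abelian.Ext.{w₂} (A i) B 1) where
  toFun η i := (Abelian.Ext.mk₀ (Sigma.ι A i)).comp η (zero_add 1)
  map_zero' := by ext i; simp
  map_add' η η' := by ext i; simp

/-! The implications form a cycle. If coproducts are exact, quasi-isomorphisms are stable under
them, so fractions can be summed and `Q` preserves coproducts; hence D^{≥0} is closed under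
coproducts. If the t-structure is smashing, a coproduct in D(𝒜) of stalk complexes lies in the
heart, and full faithfulness of `singleFunctor` identifies it with the coproduct in 𝒜. Mapping such
a coproduct into B[1] gives the statement on Ext¹.

Only surjectivity is needed to return to exactness. For monos Aᵢ → Bᵢ with cokernels Cᵢ, the
extension classes pushed to ∐ A come from one class η on ∐ C. Some mono g : ∐ A → E kills η, so g
extends along ∐ A → ∐ B, which is therefore mono. -/

/-! ### Quasi-isomorphisms and exact colimits -/

namespace CategoryTheory.ShortComplex

variable {C : Type*} [Category* C] [Abelian C] {J : Type*} [Category* J]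

lemma quasiIso_of_evaluation {S₁ S₂ : ShortComplex (J ⥤ C)} (φ : S₁ ⟶ S₂)
    (hφ : ∀ j, QuasiIso (((evaluation J C).obj j).mapShortComplex.map φ)) : QuasiIso φ := by
  have (j : J) : IsIso ((homologyMap φ).app j) := by
    have := (quasiIso_iff _).1 (hφ j)
    have e : ((evaluation J C).obj j).map (homologyMap φ) = _ :=
      (Iso.eq_inv_comp _).2 (mapHomologyIso_hom_naturality φ ((evaluation J C).obj j)).symm
    have h : IsIso (((evaluation J C).obj j).map (homologyMap φ)) := by
      rw [e]
      exact IsIso.comp_isIso' (Iso.isIso_inv _) (IsIso.comp_isIso' this (Iso.isIso_hom _))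
    exact h
  rw [quasiIso_iff]
  exact NatIso.isIso_of_isIso_app _

end CategoryTheory.ShortComplex

namespace HomologicalComplex

variable {C : Type*} [Category* C] [Abelian C] {J : Type*} [Category* J]
  {ι : Type*} {c : ComplexShape ι}

/-- The differential, as a natural transformation between evaluation functors. -/
def evalD (K : J ⥤ HomologicalComplex C c) (i j : ι) : K ⋙ eval C c i ⟶ K ⋙ eval C c j where
  app k := (K.obj k).d i j
  naturality _ _ f := (K.map f).comm i j

/-- A functor to complexes, seen in degree `n` as a short complex of functors. -/
noncomputable abbrev functorSc (K : J ⥤ HomologicalComplex C c) (n : ι) : ShortComplex (J ⥤ C) :=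
  ShortComplex.mk (evalD K (c.prev n) n) (evalD K n (c.next n)) (by
    ext k
    exact (K.obj k).d_comp_d _ _ _)

/-- The morphism of short complexes of functors induced by a natural transformation. -/
noncomputable abbrev functorScMap {K L : J ⥤ HomologicalComplex C c} (φ : K ⟶ L) (n : ι) :
    functorSc K n ⟶ functorSc L n :=
  ShortComplex.homMk (Functor.whiskerRight φ (eval C c (c.prev n)))
    (Functor.whiskerRight φ (eval C c n)) (Functor.whiskerRight φ (eval C c (c.next n)))
    (by ext k; exact (φ.app k).comm _ _) (by ext k; exact (φ.app k).comm _ _)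

variable [HasColimitsOfShape J C] {K : J ⥤ HomologicalComplex C c} {s : Cocone K}

/-- Colimits of complexes are computed degreewise. -/
noncomputable def colimEvalIso (hs : IsColimit s) (n : ι) :
    colimit (K ⋙ eval C c n) ≅ s.pt.X n :=
  (colimit.isColimit _).coconePointUniqueUpToIso (isColimitOfPreserves (eval C c n) hs)

@[simp]
lemma ι_colimEvalIso_hom (hs : IsColimit s) (n : ι) (j : J) :
    colimit.ι (K ⋙ eval C c n) j ≫ (colimEvalIso hs n).hom = (s.ι.app j).f n :=
  (colimit.isColimit (K ⋙ eval C c n)).comp_coconePointUniqueUpToIso_hom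
    (isColimitOfPreserves (eval C c n) hs) j

lemma ι_colimEvalIso_hom_assoc (hs : IsColimit s) (n : ι) (j : J) {Z : C} (g : s.pt.X n ⟶ Z) :
    colimit.ι (K ⋙ eval C c n) j ≫ (colimEvalIso hs n).hom ≫ g = (s.ι.app j).f n ≫ g := by
  rw [← Category.assoc]
  exact congrArg (· ≫ g) (ι_colimEvalIso_hom hs n j)

lemma colimMap_evalD (hs : IsColimit s) (i j : ι) :
    (colimEvalIso hs i).hom ≫ s.pt.d i j = colimMap (evalD K i j) ≫ (colimEvalIso hs j).hom := by
  apply colimit.hom_ext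
  intro k
  rw [ι_colimEvalIso_hom_assoc, ι_colimMap_assoc, ι_colimEvalIso_hom]
  exact (s.ι.app k).comm i j

lemma colimMap_whiskerRight_eval {L : J ⥤ HomologicalComplex C c} {t : Cocone L}
    (hs : IsColimit s) (ht : IsColimit t) (f : K ⟶ L) (φ : s.pt ⟶ t.pt)
    (hφ : ∀ j, s.ι.app j ≫ φ = f.app j ≫ t.ι.app j) (n : ι) :
    colimMap (Functor.whiskerRight f (eval C c n)) ≫ (colimEvalIso ht n).hom =
      (colimEvalIso hs n).hom ≫ φ.f n := by
  apply colimit.hom_ext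
  intro k
  rw [ι_colimEvalIso_hom_assoc, ι_colimMap_assoc, ι_colimEvalIso_hom]
  exact (congr_hom (hφ k) n).symm

/-- The colimit of the short complexes in degree `n` is the short complex of the colimit. -/
noncomputable def colimFunctorScIso (hs : IsColimit s) (n : ι) :
    (colim (J := J) (C := C)).mapShortComplex.obj (functorSc K n) ≅
      (shortComplexFunctor C c n).obj s.pt :=
  ShortComplex.isoMk (colimEvalIso hs _) (colimEvalIso hs _) (colimEvalIso hs _)
    (colimMap_evalD hs _ _) (colimMap_evalD hs _ _)

/-- Homology of functors is computed pointwise, and the exact functor `colim` preserves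
quasi-isomorphisms of short complexes; this is applied in each degree. -/
instance quasiIso_isStableUnderColimitsOfShape [HasExactColimitsOfShape J C] :
    (quasiIso C c).IsStableUnderColimitsOfShape J where
  condition K L s t hs ht f hf φ hφ := by
    rw [mem_quasiIso_iff]
    have hf' (j : J) : QuasiIso (f.app j) := hf j
    refine ⟨fun n => ?_⟩
    rw [quasiIsoAt_iff]
    have : ShortComplex.QuasiIso (functorScMap f n) := by
      apply ShortComplex.quasiIso_of_evaluation
      intro j
      exact (quasiIsoAt_iff (f.app j) n).1 inferInstance
    have h : ShortComplex.QuasiIso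
        ((colim (J := J) (C := C)).mapShortComplex.map (functorScMap f n)) :=
      inferInstance
    have comm : (colim (J := J) (C := C)).mapShortComplex.map (functorScMap f n) ≫
        (colimFunctorScIso ht n).hom =
        (colimFunctorScIso hs n).hom ≫ (shortComplexFunctor C c n).map φ := by
      ext
      · exact colimMap_whiskerRight_eval hs ht f φ hφ _
      · exact colimMap_whiskerRight_eval hs ht f φ hφ _
      · exact colimMap_whiskerRight_eval hs ht f φ hφ _
    rw [← Iso.inv_comp_eq] at comm
    change ShortComplex.QuasiIso ((shortComplexFunctor C c n).map φ)
    rw [← comm]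
    infer_instance

lemma quasiIso_of_isColimit_cofan {I : Type*} [HasColimitsOfShape (Discrete I) C]
    [HasExactColimitsOfShape (Discrete I) C] {X : I → HomologicalComplex C c}
    {X' : I → HomologicalComplex C c} {s : Cofan X} (hs : IsColimit s)
    {s' : Cofan X'} (hs' : IsColimit s') (φ : ∀ i, X' i ⟶ X i) [∀ i, QuasiIso (φ i)]
    (f : s'.pt ⟶ s.pt) (hf : ∀ i, s'.inj i ≫ f = φ i ≫ s.inj i) : QuasiIso f :=
  (HomologicalComplex.quasiIso C c).colimitsOfShape_le (J := Discrete I) _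
    (MorphismProperty.colimitsOfShape.mk' _ _ _ _ hs' hs (Discrete.natTrans fun i => φ i.as)
      (fun i => (inferInstance : QuasiIso (φ i.as))) _ (fun i => hf i.as))

end HomologicalComplex

namespace CategoryTheory

variable {C : Type*} [Category* C] [Abelian C]

/-- Null-homotopies of the restrictions to the summands of a coproduct of complexes assemble into a
null-homotopy. -/
noncomputable def Homotopy.ofCofan {ι : Type*} {c : ComplexShape ι} {I : Type*}
    [HasColimitsOfShape (Discrete I) C]
    {X : I → HomologicalComplex C c} {s : Cofan X} (hs : IsColimit s)
    {Y : HomologicalComplex C c} (f : s.pt ⟶ Y) (h : ∀ i, Homotopy (s.inj i ≫ f) 0) :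
    Homotopy f 0 :=
  have hs' (n : ι) := isColimitOfPreserves (HomologicalComplex.eval C c n) hs
  let φ (n m : ι) : s.pt.X n ⟶ Y.X m := (hs' n).desc
    (Cocone.mk (Y.X m) (Discrete.natTrans (fun i => (h i.as).hom n m)))
  have hφ (i : I) (n m : ι) : (s.inj i).f n ≫ φ n m = (h i).hom n m := (hs' n).fac _ ⟨i⟩
  { hom := φ
    zero n m hnm := by
      apply (hs' n).hom_ext
      rintro ⟨i⟩
      exact (hφ i n m).trans (((h i).zero n m hnm).trans comp_zero.symm)
    comm n := by
      apply (hs' n).hom_ext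
      rintro ⟨i⟩
      change (s.inj i).f n ≫ f.f n = (s.inj i).f n ≫ (dNext n φ + prevD n φ + 0)
      rw [add_zero, Preadditive.comp_add, ← dNext_comp_left, ← prevD_comp_left]
      have := (h i).comm n
      simp only [HomologicalComplex.zero_f, add_zero] at this
      simpa only [hφ, HomologicalComplex.comp_f] using this }

end CategoryTheory

/-! ### Coproducts in the derived category -/

namespace DerivedCategory

variable {C : Type u} [Category.{v} C] [Abelian C] [HasDerivedCategory.{w₁} C]

lemma exists_homotopy_of_Q_map_eq_zero {X Y : CochainComplex C ℤ} (f : X ⟶ Y)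
    (hf : Q.map f = 0) :
    ∃ (X' : CochainComplex C ℤ) (s : X' ⟶ X) (_ : QuasiIso s), Nonempty (Homotopy (s ≫ f) 0) := by
  have h : Qh.map ((HomotopyCategory.quotient C (.up ℤ)).map f) = Qh.map 0 := by
    rw [Functor.map_zero]
    exact hf
  rw [MorphismProperty.map_eq_iff_precomp Qh (HomotopyCategory.quasiIso C (.up ℤ))] at h
  obtain ⟨X', s, hs, fac⟩ := h
  obtain ⟨X', rfl⟩ := HomotopyCategory.quotient_obj_surjective X'
  obtain ⟨s, rfl⟩ := (HomotopyCategory.quotient _ _).map_surjective s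
  rw [← isIso_Qh_map_iff] at hs
  refine ⟨X', s, (isIso_Q_map_iff_quasiIso C s).1 hs, ?_⟩
  rw [← HomotopyCategory.quotient_map_eq_zero_iff, Functor.map_comp, fac, comp_zero]

section

variable {I : Type w} [HasColimitsOfShape (Discrete I) C] [HasExactColimitsOfShape (Discrete I) C]
  {X : I → CochainComplex C ℤ}

/-- If coproducts are exact, the localization functor from cochain complexes to the derived
category preserves coproducts. -/
lemma nonempty_isColimit_Q_cofan {s : Cofan X} (hs : IsColimit s) :
    Nonempty (IsColimit (Cofan.mk (Q.obj s.pt) (fun i => Q.map (s.inj i)))) := by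
  -- Write each component as a right fraction; the coproduct `d` of the denominators is again a
  -- quasi-isomorphism and serves as a common denominator.
  have hsurj {Y : CochainComplex C ℤ} (f : ∀ i, Q.obj (X i) ⟶ Q.obj Y) :
      ∃ g : Q.obj s.pt ⟶ Q.obj Y, ∀ i, Q.map (s.inj i) ≫ g = f i := by
    choose X' t ht g hg using fun i => right_fac (f i)
    have ht' (i : I) : QuasiIso (t i) := (isIso_Q_map_iff_quasiIso C _).1 (ht i)
    let d := Cofan.IsColimit.desc (coproductIsCoproduct X') (fun i => t i ≫ s.inj i)
    have hd (i : I) : Sigma.ι X' i ≫ d = t i ≫ s.inj i := Cofan.IsColimit.fac _ _ i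
    have : QuasiIso d := HomologicalComplex.quasiIso_of_isColimit_cofan hs (coproductIsCoproduct X') t d hd
    refine ⟨inv (Q.map d) ≫ Q.map (Sigma.desc g), fun i => ?_⟩
    rw [hg, ← cancel_epi (Q.map (t i)), IsIso.hom_inv_id_assoc, ← Functor.map_comp_assoc, ← hd,
      Functor.map_comp, Category.assoc, IsIso.hom_inv_id_assoc, ← Functor.map_comp,
      Sigma.ι_desc]
  -- The numerator `g` of a left fraction becomes null-homotopic on each summand after a
  -- quasi-isomorphism; these homotopies glue on the coproduct.
  have hinj {Y : CochainComplex C ℤ} (f : Q.obj s.pt ⟶ Q.obj Y)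
      (hf : ∀ i, Q.map (s.inj i) ≫ f = 0) : f = 0 := by
    obtain ⟨Y', g, σ, _, rfl⟩ := left_fac f
    have hg (i : I) : Q.map (s.inj i ≫ g) = 0 := by
      rw [← cancel_mono (inv (Q.map σ)), Functor.map_comp, Category.assoc, hf, zero_comp]
    choose X' t ht H using fun i => exists_homotopy_of_Q_map_eq_zero _ (hg i)
    let d := Cofan.IsColimit.desc (coproductIsCoproduct X') (fun i => t i ≫ s.inj i)
    have hd (i : I) : Sigma.ι X' i ≫ d = t i ≫ s.inj i := Cofan.IsColimit.fac _ _ i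
    have : QuasiIso d := HomologicalComplex.quasiIso_of_isColimit_cofan hs (coproductIsCoproduct X') t d hd
    have : Homotopy (d ≫ g) 0 := Homotopy.ofCofan (coproductIsCoproduct X') _ (fun i =>
      (Homotopy.ofEq (by rw [← Category.assoc, ← Category.assoc, ← hd]; rfl)).trans (H i).some)
    have h := Q_map_eq_of_homotopy C this
    rw [Functor.map_comp, Functor.map_zero] at h
    rw [← cancel_epi (Q.map d), reassoc_of% h, zero_comp, comp_zero]
  have hlift (T : DerivedCategory C) (f : ∀ i, Q.obj (X i) ⟶ T) :
      ∃ g : Q.obj s.pt ⟶ T, ∀ i, Q.map (s.inj i) ≫ g = f i := by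
    obtain ⟨g, hg⟩ := hsurj (fun i => f i ≫ (Q.objObjPreimageIso T).inv)
    exact ⟨g ≫ (Q.objObjPreimageIso T).hom, fun i => by simp [reassoc_of% (hg i)]⟩
  choose g hg using hlift
  refine ⟨Cofan.IsColimit.mk _ (fun t => g t.pt t.inj) (fun t i => hg t.pt t.inj i) ?_⟩
  intro t m hm
  rw [← sub_eq_zero, ← cancel_mono (Q.objObjPreimageIso t.pt).inv, zero_comp]
  apply hinj
  intro i
  have h₁ : Q.map (s.inj i) ≫ m = t.inj i := hm i
  rw [← Category.assoc, Preadditive.comp_sub, h₁, hg, sub_self, zero_comp]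

lemma hasColimitsOfShape_discrete : HasColimitsOfShape (Discrete I) (DerivedCategory C) where
  has_colimit F := by
    let X (i : I) : CochainComplex C ℤ := Q.objPreimage (F.obj ⟨i⟩)
    let e : F ≅ Discrete.functor (fun i => Q.obj (X i)) :=
      Discrete.natIso (fun i => (Q.objObjPreimageIso (F.obj i)).symm)
    obtain ⟨h⟩ := nonempty_isColimit_Q_cofan (coproductIsCoproduct X)
    have : HasColimit (Discrete.functor (fun i => Q.obj (X i))) := ⟨_, h⟩
    exact hasColimit_of_iso e

lemma t_ge_of_isColimit_cofan {n : ℤ} {A : I → DerivedCategory C} {s : Cofan A}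
    (hs : IsColimit s) (hA : ∀ i, TStructure.t.ge n (A i)) : TStructure.t.ge n s.pt := by
  choose K e hK using hA
  obtain ⟨h⟩ := nonempty_isColimit_Q_cofan (coproductIsCoproduct K)
  have e' : s.pt ≅ Q.obj (∐ K) :=
    IsColimit.coconePointsIsoOfNatIso hs h (Discrete.natIso (fun i => e i.as))
  refine ⟨∐ K, e', ?_⟩
  rw [CochainComplex.isStrictlyGE_iff]
  intro m hm
  rw [IsZero.iff_id_eq_zero]
  apply (isColimitOfPreserves (HomologicalComplex.eval C _ m) (coproductIsCoproduct K)).hom_ext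
  rintro ⟨i⟩
  exact ((K i).isZero_of_isStrictlyGE n m hm).eq_of_src _ _

end

lemma hasCoproducts_and_isSmashing_of_AB4 [HasCoproducts.{w} C] [AB4OfSize.{w} C] :
    HasCoproducts.{w} (DerivedCategory C) ∧
      IsSmashing.{w} (TStructure.t : Triangulated.TStructure (DerivedCategory C)) := by
  refine ⟨fun I => hasColimitsOfShape_discrete, ?_⟩
  ext Y
  constructor
  · rintro ⟨I, X, μ, hX, ⟨h⟩⟩
    exact t_ge_of_isColimit_cofan h hX
  · intro hY
    refine ⟨PUnit, fun _ => Y, fun _ => 𝟙 Y, fun _ => hY, ⟨?_⟩⟩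
    exact Cofan.IsColimit.mk _ (fun t => t.inj ⟨⟩) (fun t _ => Category.id_comp _)
      (fun t m hm => (Category.id_comp m).symm.trans (hm ⟨⟩))

end DerivedCategory

/-! ### Smashing t-structures and the heart -/

namespace CategoryTheory.Triangulated.TStructure

variable {D : Type*} [Category* D] [Preadditive D] [HasZeroObject D] [HasShift D ℤ]
  [∀ n : ℤ, (shiftFunctor D n).Additive] [Pretriangulated D]

/-- The aisle is a left orthogonal, so no exactness or smashing hypothesis is needed. -/
lemma isLE_of_isColimit_cofan (t : TStructure D) {n : ℤ} {I : Type*} {X : I → D} {s : Cofan X}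
    (hs : IsColimit s) (hX : ∀ i, t.IsLE (X i) n) : t.IsLE s.pt n := by
  rw [t.isLE_iff_orthogonal n (n + 1) rfl]
  intro Y f _
  apply Cofan.IsColimit.hom_ext hs
  intro i
  rw [comp_zero]
  exact t.zero _ n (n + 1) (by lia)

end CategoryTheory.Triangulated.TStructure

namespace DerivedCategory

variable {C : Type u} [Category.{v} C] [Abelian C] [HasDerivedCategory.{w₁} C]

lemma nonempty_isColimit_singleFunctor_of_isSmashing [HasCoproducts.{w} C]
    [HasCoproducts.{w} (DerivedCategory C)]
    (h : IsSmashing.{w} (TStructure.t : Triangulated.TStructure (DerivedCategory C)))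
    {I : Type w} (A : I → C) :
    Nonempty (IsColimit (Cofan.mk ((singleFunctor C 0).obj (∐ A))
      (fun i => (singleFunctor C 0).map (Sigma.ι A i)))) := by
  let X (i : I) : DerivedCategory C := (singleFunctor C 0).obj (A i)
  have hX := coproductIsCoproduct X
  have hge : (∐ X).IsGE 0 := ⟨by
    rw [← h]
    exact ⟨I, X, _, fun i => TStructure.t.ge_of_isGE _ 0, ⟨hX⟩⟩⟩
  have hle : (∐ X).IsLE 0 :=
    TStructure.t.isLE_of_isColimit_cofan hX (fun i => inferInstanceAs ((X i).IsLE 0))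
  obtain ⟨B, ⟨e⟩⟩ := exists_iso_singleFunctor_obj_of_isGE_of_isLE (∐ X) 0
  choose b hb using fun i => (singleFunctor C 0).map_surjective (Sigma.ι X i ≫ e.hom)
  have hB : IsColimit (Cofan.mk ((singleFunctor C 0).obj B)
      (fun i => (singleFunctor C 0).map (b i))) :=
    IsColimit.ofIsoColimit hX (Cofan.ext e (fun i => (hb i).symm))
  have hB' : IsColimit (Cofan.mk B b) :=
    isColimitOfReflects (singleFunctor C 0)
      ((isColimitMapCoconeCofanMkEquiv (singleFunctor C 0) A b).symm hB)
  let e' : B ≅ ∐ A := hB'.coconePointUniqueUpToIso (coproductIsCoproduct A)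
  have he' (i : I) : b i ≫ e'.hom = Sigma.ι A i :=
    hB'.comp_coconePointUniqueUpToIso_hom (coproductIsCoproduct A) ⟨i⟩
  exact ⟨IsColimit.ofIsoColimit hB (Cofan.ext ((singleFunctor C 0).mapIso e')
    (fun i => ((singleFunctor C 0).map_comp (b i) e'.hom).symm.trans
      (congrArg (singleFunctor C 0).map (he' i))))⟩

end DerivedCategory

/-! ### Ext¹ and recovering exactness -/

namespace CategoryTheory.Abelian.Ext

variable {C : Type u} [Category.{v} C] [Abelian C]

lemma bijective_extOneCoproductComparison [HasDerivedCategory.{w₁} C] [HasExt.{w₂} C]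
    {I : Type w} (A : I → C) [HasCoproduct A] (B : C)
    (h : IsColimit (Cofan.mk ((DerivedCategory.singleFunctor C 0).obj (∐ A))
      (fun i => (DerivedCategory.singleFunctor C 0).map (Sigma.ι A i)))) :
    Function.Bijective (extOneCoproductComparison.{w, w₂} A B) := by
  have hom_eq (η : Ext.{w₂} (∐ A) B 1) (i : I) :
      (extOneCoproductComparison A B η i).hom =
        (DerivedCategory.singleFunctor C 0).map (Sigma.ι A i) ≫ η.hom :=
    (singleFunctor_map_comp_hom _ _).symm
  constructor
  · intro η η' hη
    apply Ext.ext
    apply Cofan.IsColimit.hom_ext h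
    intro i
    exact (hom_eq η i).symm.trans ((congrArg (fun x => (x i).hom) hη).trans (hom_eq η' i))
  · intro ε
    refine ⟨homEquiv.symm (Cofan.IsColimit.desc h (fun i => (ε i).hom)), ?_⟩
    funext i
    apply Ext.ext
    rw [hom_eq]
    have := homEquiv.apply_symm_apply (Cofan.IsColimit.desc h (fun i => (ε i).hom))
    refine (congrArg _ this).trans ?_
    exact Cofan.IsColimit.fac h _ i

end CategoryTheory.Abelian.Ext

namespace HomologicalComplex

variable {C : Type*} [Category* C] [Abelian C] {ι : Type*} {c : ComplexShape ι} [DecidableEq ι]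

/-- For a stalk complex, cycles and homology both agree with the object, so injectivity on homology
forces injectivity on cycles. -/
lemma mono_f_of_quasiIso_from_single {n : ι} {Y : C} {K : HomologicalComplex C c}
    (s : (single C c n).obj Y ⟶ K) [QuasiIso s] : Mono (s.f n) := by
  have := ((single C c n).obj Y).isIso_iCycles n _ rfl rfl
  have := ((single C c n).obj Y).isIso_homologyπ _ n rfl rfl
  have : Mono (cyclesMap s n ≫ K.homologyπ n) := by
    rw [← homologyπ_naturality]
    infer_instance
  have : Mono (cyclesMap s n) := mono_of_mono _ (K.homologyπ n)
  have h : s.f n = inv (((single C c n).obj Y).iCycles n) ≫ cyclesMap s n ≫ K.iCycles n := by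
    rw [cyclesMap_i, IsIso.inv_hom_id_assoc]
  rw [h]
  infer_instance

end HomologicalComplex

namespace CategoryTheory.Abelian.Ext

open _root_.DerivedCategory

variable {C : Type u} [Category.{v} C] [Abelian C] [HasExt.{w₂} C]

lemma exists_comp_mk₀_mono_eq_zero [HasDerivedCategory.{w₁} C] {X Y : C} (α : Ext.{w₂} X Y 1) :
    ∃ (E : C) (f : Y ⟶ E) (_ : Mono f), α.comp (mk₀ f) (add_zero 1) = 0 := by
  let e := (singleFunctors C).shiftIso 1 (-1) 0 (by simp)
  let β : Q.obj ((HomologicalComplex.single C (.up ℤ) 0).obj X) ⟶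
    Q.obj ((HomologicalComplex.single C (.up ℤ) (-1)).obj Y) := α.hom ≫ e.hom.app Y
  -- With `Y[1]` as a stalk in degree -1, `K` can be taken to vanish below -1. Hence projection to
  -- `K.X (-1)` is a chain map, and it kills `g`, whose source sits in degree 0.
  obtain ⟨K, _, g, s, hs, fac⟩ := left_fac_of_isStrictlyGE β (-1)
  rw [isIso_Q_map_iff_quasiIso] at hs
  let f : Y ⟶ K.X (-1) :=
    (HomologicalComplex.singleObjXSelf (.up ℤ) (-1) Y).inv ≫ s.f (-1)
  have hf : Mono f := by
    have : Mono (s.f (-1)) := HomologicalComplex.mono_f_of_quasiIso_from_single s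
    exact mono_comp _ _
  let p : K ⟶ (HomologicalComplex.single C (.up ℤ) (-1)).obj (K.X (-1)) :=
    HomologicalComplex.mkHomToSingle (𝟙 _) (fun i hi => by
      apply (K.isZero_of_isStrictlyGE (-1) i (by simp at hi; lia)).eq_of_src)
  have hsp : s ≫ p = (HomologicalComplex.single C (.up ℤ) (-1)).map f := by
    apply HomologicalComplex.from_single_hom_ext
    rw [HomologicalComplex.comp_f, HomologicalComplex.mkHomToSingle_f, HomologicalComplex.single_map_f_self]
    simp [f]
  have hgp : g ≫ p = 0 := by
    apply HomologicalComplex.to_single_hom_ext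
    exact (HomologicalComplex.isZero_single_obj_X (.up ℤ) 0 X (-1) (by simp)).eq_of_src _ _
  refine ⟨K.X (-1), f, hf, ?_⟩
  apply Ext.ext
  rw [← hom_comp_singleFunctor_map_shift, zero_hom]
  have nat : ((singleFunctor C 0).map f)⟦(1 : ℤ)⟧' ≫ e.hom.app _ =
      e.hom.app Y ≫ (singleFunctor C (-1)).map f := e.hom.naturality f
  rw [← cancel_mono (e.hom.app (K.X (-1))), Limits.zero_comp]
  refine (Category.assoc _ _ _).trans ?_
  refine (congrArg (α.hom ≫ ·) nat).trans ?_
  refine (Category.assoc _ _ _).symm.trans ?_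
  change β ≫ Q.map ((HomologicalComplex.single C (.up ℤ) (-1)).map f) = _
  rw [fac, ← hsp, Functor.map_comp, Category.assoc, IsIso.inv_hom_id_assoc, ← Functor.map_comp, hgp,
    Functor.map_zero]
  rfl

lemma mono_sigmaMap_of_surjective_extOneCoproductComparison [HasDerivedCategory.{w₁} C] {I : Type w}
    [HasColimitsOfShape (Discrete I) C]
    (h : ∀ (A : I → C) (B : C), Function.Surjective (extOneCoproductComparison.{w, w₂} A B))
    {A B : I → C} (f : ∀ i, A i ⟶ B i) [∀ i, Mono (f i)] : Mono (Limits.Sigma.map f) := by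
  let S (i : I) : ShortComplex C := ShortComplex.mk (f i) (cokernel.π (f i)) (by simp)
  have hS (i : I) : (S i).ShortExact := { exact := ShortComplex.exact_cokernel (f i) }
  obtain ⟨η, hη⟩ := h (fun i => cokernel (f i)) (∐ A)
    (fun i => (hS i).extClass.comp (mk₀ (Sigma.ι A i)) (add_zero 1))
  obtain ⟨E, g, _, hg⟩ := exists_comp_mk₀_mono_eq_zero η
  have hext (i : I) : ∃ b : B i ⟶ E, f i ≫ b = Sigma.ι A i ≫ g := by
    have hi : (mk₀ (Sigma.ι (fun i => cokernel (f i)) i)).comp η (zero_add 1) =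
        (hS i).extClass.comp (mk₀ (Sigma.ι A i)) (add_zero 1) := congrFun hη i
    -- The obstruction to extending `Sigma.ι A i ≫ g` along `f i` is the restriction of `η · g = 0`.
    obtain ⟨x, hx⟩ := contravariant_sequence_exact₁ (hS i) E (mk₀ (Sigma.ι A i ≫ g)) (add_zero 1)
      (by
        rw [← mk₀_comp_mk₀, ← comp_assoc_of_third_deg_zero, ← hi, comp_assoc_of_third_deg_zero, hg,
          comp_zero])
    obtain ⟨b, rfl⟩ := mk₀_bijective _ _ |>.2 x
    rw [mk₀_comp_mk₀] at hx
    exact ⟨b, (mk₀_bijective _ _).1 hx⟩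
  choose b hb using hext
  have : Limits.Sigma.map f ≫ Limits.Sigma.desc b = g := by
    ext i
    simp [hb]
  have : Mono (Limits.Sigma.map f ≫ Limits.Sigma.desc b) := by rwa [this]
  exact mono_of_mono _ (Limits.Sigma.desc b)

end CategoryTheory.Abelian.Ext

namespace CategoryTheory

variable {C : Type u} [Category.{v} C] [Abelian C] [HasCoproducts.{w} C]

lemma AB4OfSize.of_mono_sigmaMap (h : ∀ (I : Type w) [Nonempty I] (A B : I → C) (f : ∀ i, A i ⟶ B i)
    [∀ i, Mono (f i)], Mono (Limits.Sigma.map f)) : AB4OfSize.{w} C where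
  ofShape I := by
    have : (MorphismProperty.monomorphisms C).IsStableUnderCoproductsOfShape I := by
      apply MorphismProperty.IsStableUnderCoproductsOfShape.mk
      intro A B _ _ f hf
      have (i : I) : Mono (f i) := hf i
      -- The hypothesis covers nonempty families only; an empty coproduct is zero.
      rcases isEmpty_or_nonempty I with _ | _
      · have : IsZero (∐ A) := by
          rw [IsZero.iff_id_eq_zero]
          ext i
          exact isEmptyElim i
        exact ⟨fun _ _ _ => this.eq_of_tgt _ _⟩
      · exact h I A B f
    have : (colim (J := Discrete I) (C := C)).PreservesMonomorphisms :=
      ⟨fun φ hφ => MorphismProperty.colimMap (W := .monomorphisms C) φ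
        (fun i => (inferInstance : Mono (φ.app i)))⟩
    -- Colimits are always right exact, so preserving monos suffices.
    exact hasExactColimitsOfShape_of_preservesMono C (Discrete I)

end CategoryTheory

theorem mainTheorem7 (𝒜 : Type u) [Category.{v} 𝒜] [Abelian 𝒜]
    [HasCoproducts.{w} 𝒜] [HasDerivedCategory.{w₁} 𝒜] [HasExt.{w₂} 𝒜] :
    List.TFAE
      [ -- coproducts in `𝒜` are exact
        AB4OfSize.{w} 𝒜,
        -- `D(𝒜)` has coproducts and its standard t-structure is smashing
        HasCoproducts.{w} (DerivedCategory 𝒜) ∧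
          IsSmashing.{w} (DerivedCategory.TStructure.t : Triangulated.TStructure
            (DerivedCategory 𝒜)),
        -- coproducts in `𝒜`, with their canonical inclusions, are coproducts in `D(𝒜)`
        ∀ (I : Type w) [Nonempty I] (A : I → 𝒜),
          Nonempty (IsColimit (Cofan.mk ((DerivedCategory.singleFunctor 𝒜 0).obj (∐ A))
            (fun i => (DerivedCategory.singleFunctor 𝒜 0).map (Sigma.ι A i)))),
        -- `Ext¹` turns coproducts in the first variable into products
        ∀ (I : Type w) [Nonempty I] (A : I → 𝒜) (B : 𝒜),
          Function.Bijective (extOneCoproductComparison.{w, w₂} A B) ] := by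
  tfae_have 1 → 2 := fun _ => DerivedCategory.hasCoproducts_and_isSmashing_of_AB4
  tfae_have 2 → 3 := fun ⟨_, h⟩ _ _ A =>
    DerivedCategory.nonempty_isColimit_singleFunctor_of_isSmashing h A
  tfae_have 3 → 4 := fun h I _ A B =>
    Abelian.Ext.bijective_extOneCoproductComparison A B (h I A).some
  tfae_have 4 → 1 := fun h => AB4OfSize.of_mono_sigmaMap fun I _ _ _ f _ =>
    Abelian.Ext.mono_sigmaMap_of_surjective_extOneCoproductComparison
      (fun A B => (h I A B).2) f
  tfae_finish
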